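/- Let $G=(V,E)$ be a finite simple bipartite graph, and consider the independent-set indicator model $$I^G(x)=\prod_{\{i,j\}\in E}(1-x_ix_j),\qquad x\in\{0,1\}^V,$$ viewed as a graphical model with node potentials $\phi_i\equiv 1$ for $i\in V$ and one factor $\psi_{ij}(x_i,x_j)=1-x_ix_j$ for each edge $\{i,j\}\in E$. Let $Z(G)=\sum_{x\in\{0,1\}^V} I^G(x)$ be its partition function. Let $\mathcal T$ be the local marginal polytope, that is, the set of all families $\tau=((\tau_i)_{i\in V},(\tau_{ij})_{\{i,j\}\in E})$ of nonnegative functions on $\{0,1\}$ and on $\{0,1\}^{\{i,j\}}$, respectively, such that $\sum_{x_i}\tau_i(x_i)=1$ for every $i\in V$, and $\sum_{x_j}\tau_{ij}(x_i,x_j)=\tau_i(x_i)$ for every edge $\{i,j\}\in E$, both of its endpoints $i$ (with $j$ the other one) and every $x_i\in\{0,1\}$. For $\tau\in\mathcal T$ put $$\log Z_{\mathrm B}(G,\tau)=\sum_{i\in V}\sum_{x_i}\tau_i(x_i)\log\phi_i(x_i)+\sum_{\{i,j\}\in E}\sum_{x_i,x_j}\tau_{ij}(x_i,x_j)\log\psi_{ij}(x_i,x_j)-\sum_{i\in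 V}\sum_{x_i}\tau_i(x_i)\log\tau_i(x_i)-\sum_{\{i,j\}\in E}\sum_{x_i,x_j}\tau_{ij}(x_i,x_j)\log\frac{\tau_{ij}(x_i,x_j)}{\tau_i(x_i)\tau_j(x_j)},$$ with the conventions $\log 0=-\infty$, $0\cdot\log 0=0\cdot\log\tfrac00=0$ and $e^{-\infty}=0$. Then the Bethe partition function $$Z_{\mathrm B}(G)=\max_{\tau\in\mathcal T}Z_{\mathrm B}(G,\tau)$$ is well defined (the maximum is attained), $Z(G)$ is the number of independent sets of $G$ (the empty set included), and $$Z_{\mathrm B}(G)\le Z(G).$$ -/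

import Mathlib

open scoped ENNReal

/-- A graphical model with binary variables, given by a factor graph with variable nodes `V` and
factor nodes `factors` (a set of nonempty subsets of `V`), together with nonnegative potentials
`φ_i` at the variable nodes and `ψ_α` at the factor nodes. -/
structure BinaryModel (V : Type*) where
  factors : Finset (Finset V)
  factors_nonempty : ∀ α ∈ factors, α.Nonempty
  nodePot : V → Fin 2 → ℝ
  nodePot_nonneg : ∀ i a, 0 ≤ nodePot i a
  factorPot : (α : factors) → (α.1 → Fin 2) → ℝ
  factorPot_nonneg : ∀ α x, 0 ≤ factorPot α x

namespace BinaryModel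

noncomputable section

variable {V : Type*} [Fintype V] [DecidableEq V]

/-- `f(x) = ∏_i φ_i(x_i) ∏_α ψ_α(x_α)`, where `x_α` is the restriction of `x` to `α`. -/
def weight (M : BinaryModel V) (x : V → Fin 2) : ℝ :=
  (∏ i, M.nodePot i (x i)) * ∏ α : M.factors, M.factorPot α (fun i => x i.1)

/-- The partition function `Z = ∑_x f(x)`. -/
def partitionFunction (M : BinaryModel V) : ℝ :=
  ∑ x : V → Fin 2, M.weight x

/-- Families `τ = ((τ_i)_i, (τ_α)_α)` of real functions on the values `x_i` of the single variables
and on the values `x_α` of the tuples of variables in the factors. -/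
abbrev PseudoMarginal (M : BinaryModel V) : Type _ :=
  (V → Fin 2 → ℝ) × ((α : M.factors) → (α.1 → Fin 2) → ℝ)

/-- The local marginal polytope. -/
def localMarginalPolytope (M : BinaryModel V) : Set M.PseudoMarginal :=
  {τ | (∀ i a, 0 ≤ τ.1 i a) ∧ (∀ α x, 0 ≤ τ.2 α x) ∧
    (∀ (α : M.factors) (i : α.1) (a : Fin 2),
      ∑ x : α.1 → Fin 2 with x i = a, τ.2 α x = τ.1 i.1 a) ∧
    ∀ i, ∑ a, τ.1 i a = 1}

/-- The energy part of `log Z_B(τ)`, with the conventions `log 0 = -∞` and `0 · (-∞) = 0`. -/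
def betheEnergy (M : BinaryModel V) (τ : M.PseudoMarginal) : EReal :=
  (∑ i, ∑ a, (τ.1 i a : EReal) * ENNReal.log (ENNReal.ofReal (M.nodePot i a))) +
    ∑ α : M.factors, ∑ x : α.1 → Fin 2,
      (τ.2 α x : EReal) * ENNReal.log (ENNReal.ofReal (M.factorPot α x))

/-- The entropy part of `log Z_B(τ)`. On the local marginal polytope all its terms are finite, with
`0 · log 0 = 0`: where `τ_α(x_α) > 0`, all `τ_i(x_i)` with `i ∈ α` are positive too. -/
def betheEntropy (M : BinaryModel V) (τ : M.PseudoMarginal) : ℝ :=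
  -(∑ i, ∑ a, τ.1 i a * Real.log (τ.1 i a)) -
    ∑ α : M.factors, ∑ x : α.1 → Fin 2,
      τ.2 α x * Real.log (τ.2 α x / ∏ i : α.1, τ.1 i.1 (x i))

/-- `Z_B(τ)`: the exponential of energy plus entropy, equal to `0` where `log Z_B(τ) = -∞`. -/
def betheApprox (M : BinaryModel V) (τ : M.PseudoMarginal) : ℝ≥0∞ :=
  EReal.exp (M.betheEnergy τ + (M.betheEntropy τ : EReal))

/-- The Bethe partition function: the maximum of `Z_B(τ)` over the local marginal polytope, written
as a supremum in `[0, ∞]`. -/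
def bethePartitionFunction (M : BinaryModel V) : ℝ≥0∞ :=
  sSup (M.betheApprox '' M.localMarginalPolytope)

end

end BinaryModel

/-- The independent-set indicator model `∏_{(i,j) ∈ E} (1 - x_i x_j)` of a graph: constant node
potentials `1`, one factor `{i, j}` for each edge, with the potential `1 - x_i x_j`. -/
noncomputable def independentSetModel {V : Type*} [Fintype V] [DecidableEq V]
    (G : SimpleGraph V) [DecidableRel G.Adj] : BinaryModel V where
  factors := G.edgeFinset.image Sym2.toFinset
  factors_nonempty := by
    intro α hα
    obtain ⟨e, -, rfl⟩ := Finset.mem_image.1 hα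
    induction e with
    | _ i j => exact ⟨i, by simp⟩
  nodePot := fun _ _ => 1
  nodePot_nonneg := fun _ _ => zero_le_one
  factorPot := fun α x => 1 - ∏ i : α.1, ((x i : ℕ) : ℝ)
  factorPot_nonneg := by
    intro α x
    refine sub_nonneg.2 (Finset.prod_le_one (fun i _ => Nat.cast_nonneg _) fun i _ => ?_)
    exact_mod_cast Nat.lt_succ_iff.1 (x i).isLt

/-! A pseudomarginal that charges `(1, 1)` on some edge has Bethe value `0`. Otherwise the pair
marginals are determined by `p i = τ_i(1)`, so everything reduces to a continuous function F =
`indepBethe` on the compact set `indepPolytope`. The maximum is therefore attained, and F ≤ log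
(number of independent sets) remains to be shown.

This goes by clamping one vertex at a time. Vertices outside a set S are frozen at `p i = 0`, which
plays the role of deleting them from the graph. Suppose F is at most a₀ on the face `p v = 0` and at
most a₁ on the face `p v = 1`. Then F minus the binary entropy of `p v` is at most the chord (1 - p
v) a₀ + p v a₁ (`IsBipartite.indepBethe_le_of_clamp`). Taking a₀, a₁ to be logarithms of counts,
Gibbs' inequality (`binEntropy_add_log_le`) and the recursion `numIndep_clamp` close a strong
induction on S.

For the chord bound, consider a maximiser of the difference, perturbed by a small multiple of p v (1
- p v). If the maximum is positive, all unfrozen coordinates and all edge constraints are strict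
there. But F without the entropy of v has nonnegative second derivative along some direction that
moves v (`IsBipartite.exists_direction`), and the perturbation makes it positive, contradicting
maximality. Bipartiteness enters only there: the direction has opposite signs on the two colour
classes. -/

set_option linter.unusedSectionVars false

/-! ### The Bethe entropy as a function of node marginals, and its derivatives -/

namespace SimpleGraph

open Real Function

variable {V : Type*} [Fintype V] [DecidableEq V] (G : SimpleGraph V) [DecidableRel G.Adj]

/-- The Bethe entropy of the independent set model of `G`, as a function of the marginal
probabilities `p i` that `i` belongs to the independent set. -/
noncomputable def indepBethe (p : V → ℝ) : ℝ :=
  ∑ i, (negMulLog (p i) + negMulLog (1 - p i) +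
    ∑ k ∈ G.neighborFinset i, (negMulLog (1 - p i - p k) / 2 - negMulLog (1 - p i)))

/-- The gradient of `indepBethe`. -/
noncomputable def indepBetheGrad (p : V → ℝ) (i : V) : ℝ :=
  log (1 - p i) - log (p i) +
    ∑ k ∈ G.neighborFinset i, (log (1 - p i - p k) - log (1 - p i))

/-- The polytope of the marginals `p` with `p i + p j ≤ 1` for every edge `ij`. -/
def indepPolytope : Set (V → ℝ) :=
  {p | (∀ i, 0 ≤ p i) ∧ (∀ i, p i ≤ 1) ∧ ∀ i j, G.Adj i j → p i + p j ≤ 1}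

theorem isCompact_indepPolytope : IsCompact G.indepPolytope := by
  refine (isCompact_univ_pi fun _ : V => isCompact_Icc (a := (0 : ℝ)) (b := 1)).of_isClosed_subset
    ?_ fun p hp i _ => ⟨hp.1 i, hp.2.1 i⟩
  simp only [indepPolytope, Set.ofPred_and, Set.ofPred_forall]
  refine ((isClosed_iInter fun i => ?_).inter ((isClosed_iInter fun i => ?_).inter
    (isClosed_iInter fun i => isClosed_iInter fun j => isClosed_iInter fun _ => ?_)))
  · exact isClosed_le (by fun_prop) (by fun_prop)
  · exact isClosed_le (by fun_prop) (by fun_prop)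
  · exact isClosed_le (by fun_prop) (by fun_prop)

theorem continuous_indepBethe : Continuous G.indepBethe := by
  have := continuous_negMulLog
  unfold indepBethe
  fun_prop

theorem sum_neighborFinset_comm (f : V → V → ℝ) :
    ∑ i, ∑ k ∈ G.neighborFinset i, f i k = ∑ i, ∑ k ∈ G.neighborFinset i, f k i := by
  simp only [neighborFinset_eq_filter, Finset.sum_filter]
  rw [Finset.sum_comm]
  simp only [G.adj_comm]

/-- The alternative `e = 0` covers frozen coordinates: there the argument may vanish, but the
function is constant in `t`. -/
theorem hasDerivAt_log_affine {c e : ℝ} {t : ℝ} (h : c + t * e ≠ 0 ∨ e = 0) :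
    HasDerivAt (fun t => log (c + t * e)) (e / (c + t * e)) t := by
  rcases h with h | rfl
  · have h1 : HasDerivAt (fun t => c + t * e) e t := by
      simpa using ((hasDerivAt_id t).mul_const e).const_add c
    exact h1.log h
  · simpa using hasDerivAt_const t (log c)

theorem hasDerivAt_negMulLog_affine {c e : ℝ} {t : ℝ} (h : c + t * e ≠ 0 ∨ e = 0) :
    HasDerivAt (fun t => negMulLog (c + t * e)) ((-log (c + t * e) - 1) * e) t := by
  rcases h with h | rfl
  · have h1 : HasDerivAt (fun t => c + t * e) e t := by
      simpa using ((hasDerivAt_id t).mul_const e).const_add c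
    exact (hasDerivAt_negMulLog h).comp t h1
  · simpa using hasDerivAt_const t (negMulLog c)

variable {G}

theorem hasDerivAt_indepBethe {x w : V → ℝ} {t : ℝ}
    (hv : ∀ i, (x i + t * w i ≠ 0 ∧ 1 - (x i + t * w i) ≠ 0) ∨ w i = 0)
    (he : ∀ i k, G.Adj i k → 1 - (x i + t * w i) - (x k + t * w k) ≠ 0 ∨ w i + w k = 0) :
    HasDerivAt (fun t => G.indepBethe (fun i => x i + t * w i))
      (∑ i, w i * G.indepBetheGrad (fun i => x i + t * w i) i) t := by
  have key : HasDerivAt (fun t => G.indepBethe (fun i => x i + t * w i))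
      (∑ i, ((-log (x i + t * w i) - 1) * w i + (-log ((1 - x i) + t * (-w i)) - 1) * (-w i) +
        ∑ k ∈ G.neighborFinset i,
          ((-log ((1 - x i - x k) + t * (-(w i + w k))) - 1) * (-(w i + w k)) / 2 -
            (-log ((1 - x i) + t * (-w i)) - 1) * (-w i)))) t := by
    have e1 : ∀ (t : ℝ) (i : V), 1 - (x i + t * w i) = (1 - x i) + t * (-w i) :=
      fun t i => by ring
    have e2 : ∀ (t : ℝ) (i k : V), (1 - x i) + t * (-w i) - (x k + t * w k) =
      (1 - x i - x k) + t * (-(w i + w k)) := fun t i k => by ring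
    simp only [indepBethe, e1, e2] at hv he ⊢
    refine HasDerivAt.fun_sum fun i _ => ?_
    have h1 : HasDerivAt (fun t => negMulLog ((1 - x i) + t * (-w i)))
        ((-log ((1 - x i) + t * (-w i)) - 1) * (-w i)) t :=
      hasDerivAt_negMulLog_affine ((hv i).imp And.right fun h => by simp [h])
    refine ((hasDerivAt_negMulLog_affine ((hv i).imp And.left id)).add h1).add
      (HasDerivAt.fun_sum fun k hk => ?_)
    refine HasDerivAt.sub (HasDerivAt.div_const (hasDerivAt_negMulLog_affine ?_) 2) h1
    exact (he i k (by simpa using hk)).imp id fun h => by simp [h]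
  convert key using 1
  -- Each edge entropy is split evenly between its endpoints; swapping them moves the half
  -- multiplied by `w k` into the gradient component of the other endpoint.
  have hs := G.sum_neighborFinset_comm fun i k =>
    w k * (log (1 - (x i + t * w i) - (x k + t * w k)) + 1) / 2
  have e3 : ∀ i k, (1 - x i - x k) + t * (-(w i + w k)) =
      1 - (x i + t * w i) - (x k + t * w k) := fun i k => by ring
  have e4 : ∀ i, (1 - x i) + t * (-w i) = 1 - (x i + t * w i) := fun i => by ring
  have e5 : ∀ i k, 1 - (x k + t * w k) - (x i + t * w i) =
      1 - (x i + t * w i) - (x k + t * w k) := fun i k => by ring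
  simp only [e5] at hs
  simp only [indepBetheGrad, e3, e4]
  rw [← sub_eq_zero] at hs ⊢
  rw [← neg_eq_zero, ← hs, ← Finset.sum_sub_distrib, ← Finset.sum_sub_distrib,
    ← Finset.sum_neg_distrib]
  refine Finset.sum_congr rfl fun i _ => ?_
  rw [mul_add, Finset.mul_sum, ← Finset.sum_sub_distrib]
  rw [neg_sub, add_sub_add_comm, ← Finset.sum_sub_distrib, add_eq_right.2 (by ring)]
  exact Finset.sum_congr rfl fun k _ => by ring

/-- The derivative is the `i`-th entry of the Hessian at `x` applied to `w`. -/
theorem hasDerivAt_indepBetheGrad {x w : V → ℝ}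
    (hv : ∀ i, (x i ≠ 0 ∧ 1 - x i ≠ 0) ∨ w i = 0)
    (he : ∀ i k, G.Adj i k → 1 - x i - x k ≠ 0) (i : V) :
    HasDerivAt (fun t : ℝ => G.indepBetheGrad (fun i => x i + t * w i) i)
      (-w i / (1 - x i) - w i / x i +
        ∑ k ∈ G.neighborFinset i, (-(w i + w k) / (1 - x i - x k) - -w i / (1 - x i))) 0 := by
  have e1 : ∀ (t : ℝ) (i : V), 1 - (x i + t * w i) = (1 - x i) + t * (-w i) :=
    fun t i => by ring
  have e2 : ∀ (t : ℝ) (i k : V), (1 - x i) + t * (-w i) - (x k + t * w k) =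
    (1 - x i - x k) + t * (-(w i + w k)) := fun t i k => by ring
  simp only [indepBetheGrad, e1, e2]
  have h1 : HasDerivAt (fun t => log ((1 - x i) + t * (-w i))) (-w i / (1 - x i)) 0 := by
    simpa using hasDerivAt_log_affine (c := 1 - x i) (e := -w i) (t := 0)
      ((hv i).imp (fun h => by simpa using h.2) fun h => by simp [h])
  have h0 : HasDerivAt (fun t => log (x i + t * w i)) (w i / x i) 0 := by
    simpa using hasDerivAt_log_affine (c := x i) (e := w i) (t := 0)
      ((hv i).imp (fun h => by simpa using h.1) id)
  refine (h1.sub h0).add (HasDerivAt.fun_sum fun k hk => HasDerivAt.sub ?_ h1)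
  simpa using hasDerivAt_log_affine (c := 1 - x i - x k) (e := -(w i + w k)) (t := 0)
    (Or.inl (by simpa using he i k (by simpa using hk)))

theorem indepBetheGrad_update (p : V → ℝ) (j : V) (t : ℝ) :
    G.indepBetheGrad (update p j t) j = log (1 - t) - log t +
      ∑ k ∈ G.neighborFinset j, (log (1 - t - p k) - log (1 - t)) := by
  simp only [indepBetheGrad, update_self]
  congr 1
  refine Finset.sum_congr rfl fun k hk => ?_
  rw [update_of_ne (by rintro rfl; simp at hk)]

theorem hasDerivAt_indepBethe_update {p : V → ℝ} {j : V} {t : ℝ} (h0 : t ≠ 0) (h1 : 1 - t ≠ 0)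
    (he : ∀ k, G.Adj j k → 1 - t - p k ≠ 0) :
    HasDerivAt (fun t => G.indepBethe (update p j t)) (log (1 - t) - log t +
      ∑ k ∈ G.neighborFinset j, (log (1 - t - p k) - log (1 - t))) t := by
  have e : ∀ t : ℝ, update p j t = fun i => update p j 0 i + t * (Pi.single j 1 : V → ℝ) i := by
    intro t
    ext i
    rcases eq_or_ne i j with rfl | h <;> simp [*]
  rw [← indepBetheGrad_update]
  have := hasDerivAt_indepBethe (G := G) (x := update p j 0) (w := Pi.single j 1) (t := t)
    (fun i => ?_) (fun i k hik => ?_)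
  · simp only [← e] at this
    simpa [Pi.single_apply] using this
  · rcases eq_or_ne i j with rfl | h <;> simp [*]
  · rcases eq_or_ne i j with rfl | h
    · left
      simpa [hik.ne'] using he k hik
    · rcases eq_or_ne k j with rfl | h'
      · left
        have := he i hik.symm
        simp only [update_of_ne h, update_self, Pi.single_eq_same, Pi.single_eq_of_ne h]
        intro h
        apply this
        linarith
      · right
        simp [*]

/-! ### Boundary behaviour of maximisers along a coordinate -/

/-- A maximiser of `indepBethe` in the direction of the coordinate `j` lies in the interior of the
interval of the admissible values of this coordinate. -/
theorem lt_of_forall_indepBethe_update_le {p : V → ℝ} (hp : p ∈ G.indepPolytope) {j : V}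
    (hlt : ∀ k, G.Adj j k → p k < 1)
    (hmax : ∀ t, update p j t ∈ G.indepPolytope → G.indepBethe (update p j t) ≤ G.indepBethe p) :
    0 < p j ∧ p j < 1 ∧ ∀ k, G.Adj j k → p j + p k < 1 := by
  -- `m` is the right end of the admissible interval: the minimum of `1` and of the `1 - p k` over
  -- the neighbours.
  obtain ⟨m, hm0, hm1, hmk, hm⟩ : ∃ m : ℝ, 0 < m ∧ m ≤ 1 ∧ (∀ k, G.Adj j k → m ≤ 1 - p k) ∧
      (m = 1 ∨ ∃ k, G.Adj j k ∧ m = 1 - p k) := by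
    rcases (G.neighborFinset j).eq_empty_or_nonempty with h | h
    · refine ⟨1, one_pos, le_rfl, fun k hk => ?_, Or.inl rfl⟩
      exact absurd ((G.mem_neighborFinset j k).2 hk) (by simp [h])
    · obtain ⟨k, hk, hmax⟩ := (G.neighborFinset j).exists_max_image p h
      simp only [mem_neighborFinset] at hk hmax
      exact ⟨1 - p k, by linarith [hlt k hk], by linarith [hp.1 k],
        fun l hl => by linarith [hmax l hl], Or.inr ⟨k, hk, rfl⟩⟩
  have hmem : ∀ t, 0 ≤ t → t ≤ m → update p j t ∈ G.indepPolytope := by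
    intro t h0 h1
    refine ⟨fun i => ?_, fun i => ?_, fun i k hik => ?_⟩
    · rcases eq_or_ne i j with rfl | h <;> simp [*, hp.1 i]
    · rcases eq_or_ne i j with rfl | h
      · simpa using h1.trans hm1
      · simpa [h] using hp.2.1 i
    · rcases eq_or_ne i j with rfl | h
      · simp only [update_self, update_of_ne hik.ne']
        linarith [hmk k hik]
      · rcases eq_or_ne k j with rfl | h'
        · simp only [update_self, update_of_ne h]
          linarith [hmk i hik.symm]
        · simpa [h, h'] using hp.2.2 i k hik
  have hd : ∀ t, 0 < t → t < m → HasDerivAt (fun t => G.indepBethe (update p j t))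
      (log (1 - t) - log t + ∑ k ∈ G.neighborFinset j, (log (1 - t - p k) - log (1 - t))) t :=
    fun t h0 h1 => hasDerivAt_indepBethe_update h0.ne' (by linarith)
      fun k hk => by linarith [hmk k hk]
  have hcont : Continuous fun t => G.indepBethe (update p j t) :=
    G.continuous_indepBethe.comp (by fun_prop)
  have hself : G.indepBethe (update p j (p j)) = G.indepBethe p := by rw [update_eq_self]
  have hjm : p j ≤ m := by
    rcases hm with rfl | ⟨k, hk, rfl⟩
    · exact hp.2.1 j
    · linarith [hp.2.2 j k hk]
  have hjne : p j ≠ m := by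
    intro h
    have hanti : StrictAntiOn (fun t => G.indepBethe (update p j t)) (Set.Icc (m / 2) m) := by
      refine strictAntiOn_of_deriv_neg (convex_Icc _ _) hcont.continuousOn fun t ht => ?_
      rw [interior_Icc] at ht
      obtain ⟨ht1, ht2⟩ := ht
      rw [(hd t (by linarith) ht2).deriv]
      have hle : ∀ k ∈ G.neighborFinset j, log (1 - t - p k) - log (1 - t) ≤ 0 := by
        intro k hk
        have hk' : G.Adj j k := by simpa using hk
        exact sub_nonpos.2 (log_le_log (by linarith [hmk k hk']) (by linarith [hp.1 k]))
      -- Past the midpoint this makes the derivative negative. If `m = 1` it bounds the node part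
      -- directly; if `m = 1 - p k`, the summand of `k` turns `log (1 - t)` into `log (m - t)`.
      have hlog : log (m - t) < log t := log_lt_log (by linarith) (by linarith)
      rcases hm with rfl | ⟨k, hk, rfl⟩
      · linarith [Finset.sum_nonpos hle]
      · have := Finset.sum_le_sum_of_subset_of_nonneg (f := fun k => -(log (1 - t - p k) - log (1 - t)))
          (Finset.singleton_subset_iff.2 ((G.mem_neighborFinset j k).2 hk))
          fun l hl _ => neg_nonneg.2 (hle l hl)
        rw [Finset.sum_singleton, Finset.sum_neg_distrib, sub_right_comm] at this
        linarith
    have := hanti (Set.left_mem_Icc.2 (by linarith)) (Set.right_mem_Icc.2 (by linarith))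
      (by linarith)
    simp only at this
    rw [← h, hself] at this
    exact this.not_ge (hmax _ (hmem _ (by linarith) (by linarith)))
  have hj0 : p j ≠ 0 := by
    intro h
    set n := (G.neighborFinset j).card
    -- For `t < δ` the node term is at least `log (1 / 2) - log t` and each of the `n` edge terms at
    -- least `log (m / 2)`, so `-log t` outweighs the rest.
    set δ := min (m / 2) (exp (log (1 / 2) + n * log (m / 2))) with hδ
    have hδ0 : 0 < δ := lt_min (by linarith) (exp_pos _)
    have hδm : δ ≤ m / 2 := min_le_left _ _
    have hmono : StrictMonoOn (fun t => G.indepBethe (update p j t)) (Set.Icc 0 δ) := by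
      refine strictMonoOn_of_deriv_pos (convex_Icc _ _) hcont.continuousOn fun t ht => ?_
      rw [interior_Icc] at ht
      obtain ⟨ht1, ht2⟩ := ht
      rw [(hd t ht1 (by linarith)).deriv]
      have hle : n • log (m / 2) ≤
          ∑ k ∈ G.neighborFinset j, (log (1 - t - p k) - log (1 - t)) := by
        refine Finset.card_nsmul_le_sum _ _ _ fun k hk => ?_
        have hk' : G.Adj j k := by simpa using hk
        have h1 : log (m / 2) ≤ log (1 - t - p k) :=
          log_le_log (by linarith) (by linarith [hmk k hk'])
        have h2 : log (1 - t) ≤ 0 := log_nonpos (by linarith) (by linarith)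
        linarith
      have h1 : log (1 / 2) ≤ log (1 - t) := log_le_log (by norm_num) (by linarith)
      have h2 : log t < log (1 / 2) + n * log (m / 2) :=
        (log_lt_iff_lt_exp ht1).2 (ht2.trans_le (min_le_right _ _))
      rw [nsmul_eq_mul] at hle
      linarith
    have := hmono (Set.left_mem_Icc.2 hδ0.le) (Set.right_mem_Icc.2 hδ0.le) hδ0
    simp only at this
    rw [← h, hself] at this
    exact this.not_ge (hmax _ (hmem _ hδ0.le (by linarith)))
  have hjlt := lt_of_le_of_ne hjm hjne
  exact ⟨lt_of_le_of_ne (hp.1 j) hj0.symm, by linarith, fun k hk => by linarith [hmk k hk]⟩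

end SimpleGraph

/-! ### A direction of nonnegative curvature -/

namespace SimpleGraph

open Real Function Filter Topology

variable {V : Type*} [Fintype V] [DecidableEq V] {G : SimpleGraph V} [DecidableRel G.Adj]

/-- The least function `d` with `d v = 1` and `d j ≥ d i * p j / (1 - p i)` on all edges. -/
theorem exists_least_propagation {p : V → ℝ} (hp : p ∈ G.indepPolytope) (hlt : ∀ i, p i < 1)
    (v : V) :
    ∃ d : V → ℝ, (∀ i, 0 ≤ d i) ∧ d v = 1 ∧ (∀ i j, G.Adj i j → d i * (p j / (1 - p i)) ≤ d j) ∧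
      ∀ j, j ≠ v → d j = 0 ∨ ∃ i, G.Adj i j ∧ d j = d i * (p j / (1 - p i)) := by
  have hr0 : ∀ i j, 0 ≤ p j / (1 - p i) := fun i j => div_nonneg (hp.1 j) (by linarith [hlt i])
  have hr1 : ∀ i j, G.Adj i j → p j / (1 - p i) ≤ 1 := fun i j hij =>
    (div_le_one (by linarith [hlt i])).2 (by linarith [hp.2.2 i j hij])
  set D : Set (V → ℝ) := {d | (∀ i, d i ∈ Set.Icc (0 : ℝ) 1) ∧ d v = 1 ∧
    ∀ i j, G.Adj i j → d i * (p j / (1 - p i)) ≤ d j} with hD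
  have hclosed : IsClosed D := by
    simp only [hD, Set.ofPred_and, Set.ofPred_forall]
    refine (isClosed_iInter fun i => ?_).inter ((isClosed_eq (by fun_prop) (by fun_prop)).inter
      (isClosed_iInter fun i => isClosed_iInter fun j => isClosed_iInter fun _ =>
        isClosed_le (by fun_prop) (by fun_prop)))
    exact isClosed_Icc.preimage (continuous_apply i)
  have hcomp : IsCompact D :=
    (isCompact_univ_pi fun _ : V => isCompact_Icc (a := (0 : ℝ)) (b := 1)).of_isClosed_subset
      hclosed fun d hd i _ => hd.1 i
  have hne : D.Nonempty := ⟨fun _ => 1, fun _ => by simp, rfl, fun i j hij => by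
    simpa using hr1 i j hij⟩
  obtain ⟨d, hd, hmin⟩ := hcomp.exists_isMinOn hne
    (f := fun d : V → ℝ => ∑ i, d i) (by fun_prop)
  refine ⟨d, fun i => (hd.1 i).1, hd.2.1, hd.2.2, fun j hj => ?_⟩
  by_contra! hcon
  obtain ⟨hj0, hjk⟩ := hcon
  have hjpos : 0 < d j := lt_of_le_of_ne (hd.1 j).1 hj0.symm
  -- If no constraint into `j` is tight, `d j` can drop to the largest lower bound imposed by its
  -- neighbours. Constraints out of `j` only relax, so the sum of `d` was not minimal.
  obtain ⟨m, hm0, hmj, hmk⟩ : ∃ m, 0 ≤ m ∧ m < d j ∧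
      ∀ i, G.Adj i j → d i * (p j / (1 - p i)) ≤ m := by
    rcases (G.neighborFinset j).eq_empty_or_nonempty with h | h
    · refine ⟨0, le_rfl, hjpos, fun k hk => ?_⟩
      exact absurd ((G.mem_neighborFinset j k).2 hk.symm) (by simp [h])
    · obtain ⟨k, hk, hmax⟩ :=
        (G.neighborFinset j).exists_max_image (fun i => d i * (p j / (1 - p i))) h
      simp only [mem_neighborFinset] at hk hmax
      exact ⟨_, mul_nonneg (hd.1 k).1 (hr0 _ _),
        lt_of_le_of_ne (hd.2.2 k j hk.symm) (hjk k hk.symm).symm, fun i hi => hmax i hi.symm⟩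
  have hmem : update d j m ∈ D := by
    refine ⟨fun i => ?_, by rw [update_of_ne hj.symm, hd.2.1], fun i k hik => ?_⟩
    · rcases eq_or_ne i j with rfl | h
      · simpa using ⟨hm0, hmj.le.trans (hd.1 i).2⟩
      · simpa [h] using hd.1 i
    · rcases eq_or_ne i j with rfl | h
      · rw [update_self, update_of_ne hik.ne']
        exact (mul_le_mul_of_nonneg_right hmj.le (hr0 _ _)).trans (hd.2.2 i k hik)
      · rcases eq_or_ne k j with rfl | h'
        · rw [update_self, update_of_ne h]
          exact hmk i hik
        · simpa [h, h'] using hd.2.2 i k hik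
  refine (isMinOn_iff.1 hmin _ hmem).not_gt (Finset.sum_lt_sum (fun i _ => ?_)
    ⟨j, Finset.mem_univ j, by simpa using hmj⟩)
  rcases eq_or_ne i j with rfl | h
  · simpa using hmj.le
  · simp [h]

/-- In a suitable direction, the second derivative of `indepBethe` without the entropy of `v` is
nonnegative. -/
theorem IsBipartite.exists_direction (hG : G.IsBipartite) {p : V → ℝ} (hp : p ∈ G.indepPolytope)
    (hlt : ∀ i, p i < 1) (hedge : ∀ i j, G.Adj i j → p i + p j < 1) {v : V} (hv : 0 < p v) :
    ∃ w : V → ℝ, (∀ i, p i = 0 → w i = 0) ∧ w v ^ 2 = 1 ∧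
      0 ≤ ∑ i, w i * (-w i / (1 - p i) - w i / p i +
        ∑ k ∈ G.neighborFinset i, (-(w i + w k) / (1 - p i - p k) - -w i / (1 - p i))) +
        (1 / (1 - p v) + 1 / p v) := by
  obtain ⟨d, hd0, hdv, hdle, hdeq⟩ := exists_least_propagation hp hlt v
  obtain ⟨c⟩ := hG
  set s : V → ℝ := fun i => if c i = 0 then 1 else -1 with hs
  have hs2 : ∀ i, s i * s i = 1 := fun i => by simp only [hs]; split_ifs <;> norm_num
  have hss : ∀ i k, G.Adj i k → s i * s k = -1 := by
    intro i k hik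
    have key : ∀ a b : Fin 2, a ≠ b →
        (if a = 0 then (1 : ℝ) else -1) * (if b = 0 then 1 else -1) = -1 := by
      intro a b
      fin_cases a <;> fin_cases b <;> simp
    exact key _ _ (c.valid hik)
  -- Every propagation factor into such an `i` is zero, so the direction stays in the face
  -- containing `p`.
  have hp0 : ∀ i, p i = 0 → d i = 0 := by
    intro i hi
    rcases hdeq i (by rintro rfl; exact hv.ne' hi) with h | ⟨k, -, h⟩
    · exact h
    · simpa [hi] using h
  refine ⟨fun i => s i * d i, fun i hi => by simp [hp0 i hi], ?_, ?_⟩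
  · simp only [hdv, mul_one, sq, hs2]
  -- The opposite signs across an edge turn the mixed term into `+ d i * d k`, so each edge
  -- contribution contains the slack of a propagation constraint.
  have hterm : ∀ i, s i * d i * (-(s i * d i) / (1 - p i) - s i * d i / p i +
        ∑ k ∈ G.neighborFinset i, (-(s i * d i + s k * d k) / (1 - p i - p k) -
          -(s i * d i) / (1 - p i))) =
      ∑ k ∈ G.neighborFinset i, d i * (d k - d i * (p k / (1 - p i))) / (1 - p i - p k) -
        d i ^ 2 * (1 / (1 - p i) + 1 / p i) := by
    intro i
    have h1 : s i * d i * (-(s i * d i) / (1 - p i) - s i * d i / p i) =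
        -(d i ^ 2 * (1 / (1 - p i) + 1 / p i)) := by
      linear_combination (-(d i ^ 2 * (1 / (1 - p i) + 1 / p i))) * hs2 i
    rw [mul_add, h1, Finset.mul_sum, neg_add_eq_sub]
    congr 1
    refine Finset.sum_congr rfl fun k hk => ?_
    have hk : G.Adj i k := by simpa using hk
    have e1 : 1 - p i ≠ 0 := by linarith [hlt i]
    have e2 : 1 - p i - p k ≠ 0 := by linarith [hedge i k hk]
    have h2 : s i * d i * (-(s i * d i + s k * d k) / (1 - p i - p k) -
          -(s i * d i) / (1 - p i)) =
        (-(d i * d i - d i * d k) / (1 - p i - p k) - -(d i * d i) / (1 - p i)) := by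
      linear_combination (d i * d i * (-1 / (1 - p i - p k) + 1 / (1 - p i))) * hs2 i -
        d i * d k / (1 - p i - p k) * hss i k hk
    rw [h2]
    field_simp
    ring
  have hnonneg : ∀ i, ∀ k ∈ G.neighborFinset i,
      0 ≤ d i * (d k - d i * (p k / (1 - p i))) / (1 - p i - p k) := by
    intro i k hk
    have hk : G.Adj i k := by simpa using hk
    exact div_nonneg (mul_nonneg (hd0 i) (sub_nonneg.2 (hdle i k hk)))
      (by linarith [hedge i k hk])
  simp only [hterm]
  rw [← Finset.add_sum_erase _ _ (Finset.mem_univ v), hdv]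
  have hrest : 0 ≤ ∑ i ∈ Finset.univ.erase v,
      (∑ k ∈ G.neighborFinset i, d i * (d k - d i * (p k / (1 - p i))) / (1 - p i - p k) -
        d i ^ 2 * (1 / (1 - p i) + 1 / p i)) := by
    refine Finset.sum_nonneg fun j hj => ?_
    rcases hdeq j (Finset.ne_of_mem_erase hj) with h | ⟨i, hij, h⟩
    · simp [h]
    rcases eq_or_ne (p j) 0 with hj0 | hj0
    · simp [hp0 j hj0]
    -- The edge back to the vertex `i` from which `d j` was propagated alone contributes exactly `d
    -- j ^ 2 * (1 / (1 - p j) + 1 / p j)`, which cancels the node term of `j`.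
    refine sub_nonneg.2 (le_trans (le_of_eq ?_) (Finset.single_le_sum (hnonneg j)
      ((G.mem_neighborFinset j i).2 hij.symm)))
    have e1 : 1 - p i ≠ 0 := by linarith [hlt i]
    have e2 : 1 - p j ≠ 0 := by linarith [hlt j]
    have e3 : 1 - p j - p i ≠ 0 := by linarith [hedge i j hij]
    rw [h]
    field_simp
    ring
  have hvn := Finset.sum_nonneg (hnonneg v)
  rw [hdv] at hvn
  linarith

/-! ### The clamping inequality -/

/-- By the second derivative test a local maximum would also be a local minimum, so `f` would be
locally constant and its second derivative zero. -/
theorem not_isLocalMax_of_deriv_deriv_pos {f f' : ℝ → ℝ} {a c : ℝ}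
    (hf : ∀ᶠ t in 𝓝 a, HasDerivAt f (f' t) t) (hf' : HasDerivAt f' c a) (hc : 0 < c) :
    ¬ IsLocalMax f a := by
  intro hmax
  have hd : deriv f =ᶠ[𝓝 a] f' := hf.mono fun t ht => ht.deriv
  have h2 : deriv (deriv f) a = c := by rw [hd.deriv_eq, hf'.deriv]
  have hmin : IsLocalMin f a := isLocalMin_of_deriv_deriv_pos (h2 ▸ hc) hmax.deriv_eq_zero
    hf.self_of_nhds.continuousAt
  have hconst : f =ᶠ[𝓝 a] fun _ => f a := by
    filter_upwards [hmin, hmax] with t h1 h2 using le_antisymm h2 h1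
  have h3 := hconst.deriv.deriv_eq
  simp [h2] at h3
  exact hc.ne' h3

/-- Clamping inequality: the Bethe entropy minus the entropy of `v` lies below the chord of its
maxima at `p v = 0` and `p v = 1`. -/
theorem IsBipartite.indepBethe_le_of_clamp (hG : G.IsBipartite) {S : Finset V} {v : V} (hvS : v ∈ S)
    {a₀ a₁ : ℝ}
    (h0 : ∀ p ∈ G.indepPolytope, (∀ i ∉ S, p i = 0) → p v = 0 → G.indepBethe p ≤ a₀)
    (h1 : ∀ p ∈ G.indepPolytope, (∀ i ∉ S, p i = 0) → p v = 1 → G.indepBethe p ≤ a₁)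
    {p : V → ℝ} (hp : p ∈ G.indepPolytope) (hpS : ∀ i ∉ S, p i = 0) :
    G.indepBethe p ≤ negMulLog (p v) + negMulLog (1 - p v) + (1 - p v) * a₀ + p v * a₁ := by
  set r : ℝ → ℝ := fun y => negMulLog y + negMulLog (1 - y) + (1 - y) * a₀ + y * a₁ with hr
  change G.indepBethe p ≤ r (p v)
  by_contra! hcon
  -- The extra term vanishes at `0` and `1`, so the bounds on both faces survive, while its
  -- concavity will give strict positivity of a second derivative.
  obtain ⟨ε, hε, hεp⟩ : ∃ ε : ℝ, 0 < ε ∧ r (p v) + ε * (p v * (1 - p v)) < G.indepBethe p := by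
    refine ⟨(G.indepBethe p - r (p v)) / 2, by linarith, ?_⟩
    have : p v * (1 - p v) ≤ 1 := by nlinarith [hp.1 v, hp.2.1 v]
    nlinarith
  set Φ : (V → ℝ) → ℝ := fun q => G.indepBethe q - (r (q v) + ε * (q v * (1 - q v))) with hΦ
  set K : Set (V → ℝ) := G.indepPolytope ∩ {q | ∀ i ∉ S, q i = 0} with hK
  have hKc : IsCompact K := by
    refine G.isCompact_indepPolytope.inter_right ?_
    simp only [Set.ofPred_forall]
    exact isClosed_iInter fun i => isClosed_iInter fun _ =>
      isClosed_eq (by fun_prop) (by fun_prop)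
  have hΦc : Continuous Φ := by
    have := G.continuous_indepBethe
    have := continuous_negMulLog
    simp only [hΦ, hr]
    fun_prop
  obtain ⟨q, ⟨hq, hqS⟩, hmax⟩ := hKc.exists_isMaxOn ⟨p, hp, hpS⟩ hΦc.continuousOn
  have hmax' : ∀ x ∈ G.indepPolytope, (∀ i ∉ S, x i = 0) → Φ x ≤ Φ q :=
    fun x hx hxS => isMaxOn_iff.1 hmax x ⟨hx, hxS⟩
  have hpos : 0 < Φ q := lt_of_lt_of_le (sub_pos.2 hεp) (hmax' p hp hpS)
  have hqv0 : q v ≠ 0 := by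
    intro h
    have := h0 q hq hqS h
    simp only [hΦ, hr, h] at hpos
    norm_num at hpos
    linarith
  have hqv1 : q v ≠ 1 := by
    intro h
    have := h1 q hq hqS h
    simp only [hΦ, hr, h] at hpos
    norm_num at hpos
    linarith
  have hqv0' : 0 < q v := lt_of_le_of_ne (hq.1 v) hqv0.symm
  have hqv1' : q v < 1 := lt_of_le_of_ne (hq.2.1 v) hqv1
  -- `Φ` differs from `indepBethe` only by a function of `q v`, so in the other coordinates the two
  -- are maximised alike.
  have hslice : ∀ j ∈ S, j ≠ v → ∀ t, update q j t ∈ G.indepPolytope →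
      G.indepBethe (update q j t) ≤ G.indepBethe q := by
    intro j hj hjv t ht
    have := hmax' _ ht fun i hi => by
      rw [update_of_ne (by rintro rfl; exact hi hj), hqS i hi]
    simp only [hΦ, update_of_ne hjv.symm] at this
    linarith
  have hlt : ∀ i, q i < 1 := by
    intro j
    rcases eq_or_ne j v with rfl | hjv
    · exact hqv1'
    by_cases hj : j ∈ S
    · refine lt_of_le_of_ne (hq.2.1 j) fun h => ?_
      -- If `q j = 1`, the edge constraints force all neighbours to `0`, so the interiority lemma
      -- already applies at `j` and excludes this.
      refine (lt_of_forall_indepBethe_update_le hq (fun k hk => ?_) (hslice j hj hjv)).2.1.ne h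
      linarith [hq.2.2 j k hk]
    · rw [hqS j hj]; exact one_pos
  have hint : ∀ j ∈ S, j ≠ v → 0 < q j ∧ q j < 1 ∧ ∀ k, G.Adj j k → q j + q k < 1 :=
    fun j hj hjv => lt_of_forall_indepBethe_update_le hq (fun k _ => hlt k) (hslice j hj hjv)
  have hedge : ∀ i k, G.Adj i k → q i + q k < 1 := by
    intro i k hik
    by_cases hi : i ∈ S
    · by_cases hiv : i = v
      · by_cases hk : k ∈ S
        · rw [add_comm]
          exact (hint k hk (by rintro rfl; exact hik.ne hiv)).2.2 i hik.symm
        · rw [hqS k hk, add_zero]; exact hlt i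
      · exact (hint i hi hiv).2.2 k hik
    · rw [hqS i hi, zero_add]; exact hlt k
  obtain ⟨w, hw0, hwv, hQ⟩ := hG.exists_direction hq hlt hedge hqv0'
  have hw0' : ∀ i, 0 < q i ∨ w i = 0 := fun i =>
    (hq.1 i).lt_or_eq.imp id fun h => hw0 i h.symm
  have ev : ∀ᶠ t in 𝓝 (0 : ℝ), (∀ i, (0 < q i + t * w i ∨ w i = 0) ∧ q i + t * w i < 1) ∧
      ∀ i k, G.Adj i k → (q i + t * w i) + (q k + t * w k) < 1 := by
    have hc : ∀ i, Tendsto (fun t => q i + t * w i) (𝓝 0) (𝓝 (q i)) := fun i => by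
      have : Continuous fun t => q i + t * w i := by fun_prop
      simpa using this.tendsto 0
    refine (eventually_all.2 fun i => ?_).and (eventually_all.2 fun i => eventually_all.2 fun k => ?_)
    · refine Eventually.and ?_ ((hc i).eventually (gt_mem_nhds (hlt i)))
      rcases hw0' i with h | h
      · exact ((hc i).eventually (lt_mem_nhds h)).mono fun t ht => Or.inl ht
      · exact Eventually.of_forall fun _ => Or.inr h
    · by_cases hik : G.Adj i k
      · exact (((hc i).add (hc k)).eventually (gt_mem_nhds (hedge i k hik))).mono fun t ht _ => ht
      · exact Eventually.of_forall fun _ h => absurd h hik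
  have hwvne : w v ≠ 0 := by rintro h; simp [h] at hwv
  refine not_isLocalMax_of_deriv_deriv_pos (a := 0) (f := fun t => Φ fun i => q i + t * w i)
    (f' := fun t => ∑ i, w i * G.indepBetheGrad (fun i => q i + t * w i) i -
      (w v * (log ((1 - q v) + t * (-w v)) - log (q v + t * w v)) - w v * a₀ + w v * a₁ +
        ε * (w v * (1 - 2 * (q v + t * w v)))))
    (c := ∑ i, w i * (-w i / (1 - q i) - w i / q i +
        ∑ k ∈ G.neighborFinset i, (-(w i + w k) / (1 - q i - q k) - -w i / (1 - q i))) -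
      (w v * (-w v / (1 - q v) - w v / q v) + ε * (w v * (-(2 * w v)))))
    ?_ ?_ ?_ ?_
  · filter_upwards [ev] with t ht
    have hF : HasDerivAt (fun t => G.indepBethe fun i => q i + t * w i)
        (∑ i, w i * G.indepBetheGrad (fun i => q i + t * w i) i) t := by
      refine hasDerivAt_indepBethe (fun i => ?_) fun i k hik => ?_
      · exact (ht.1 i).1.imp (fun h => ⟨h.ne', by linarith [(ht.1 i).2]⟩) id
      · left
        linarith [ht.2 i k hik]
    have hv0 : q v + t * w v ≠ 0 := ((ht.1 v).1.resolve_right hwvne).ne'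
    have hv1 : (1 - q v) + t * (-w v) ≠ 0 := by linarith [(ht.1 v).2]
    have hy : HasDerivAt (fun t => q v + t * w v) (w v) t := by
      simpa using ((hasDerivAt_id t).mul_const (w v)).const_add (q v)
    refine hF.sub ?_
    have e1 : ∀ t : ℝ, 1 - (q v + t * w v) = (1 - q v) + t * (-w v) := fun t => by ring
    have hn0 := hasDerivAt_negMulLog_affine (Or.inl hv0)
    have hn1 := hasDerivAt_negMulLog_affine (Or.inl hv1)
    have := ((((hn0.add hn1).add ((hy.const_sub 1).mul_const a₀)).add (hy.mul_const a₁)).add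
      ((hy.mul (hy.const_sub 1)).const_mul ε))
    simp only [← e1] at this
    simp only [hr, ← e1]
    exact this.congr_deriv (by ring)
  · refine HasDerivAt.sub (HasDerivAt.fun_sum fun i _ => HasDerivAt.const_mul _ ?_) ?_
    · refine hasDerivAt_indepBetheGrad (fun i => ?_) (fun i k hik => ?_) i
      · exact (hw0' i).imp (fun h => ⟨h.ne', by linarith [hlt i]⟩) id
      · linarith [hedge i k hik]
    · have hl1 : HasDerivAt (fun t => log ((1 - q v) + t * (-w v))) (-w v / (1 - q v)) 0 := by
        simpa using hasDerivAt_log_affine (c := 1 - q v) (e := -w v) (t := 0)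
          (Or.inl (by simpa using sub_ne_zero.2 hqv1.symm))
      have hl0 : HasDerivAt (fun t => log (q v + t * w v)) (w v / q v) 0 := by
        simpa using hasDerivAt_log_affine (c := q v) (e := w v) (t := 0)
          (Or.inl (by simpa using hqv0))
      have hy : HasDerivAt (fun t => q v + t * w v) (w v) (0 : ℝ) := by
        simpa using ((hasDerivAt_id (0 : ℝ)).mul_const (w v)).const_add (q v)
      exact ((((hl1.sub hl0).const_mul (w v)).sub_const _).add_const _).add
        ((((hy.const_mul 2).const_sub 1).const_mul (w v)).const_mul ε)
  -- As `w v ^ 2 = 1`, the second derivative is the nonnegative quantity `hQ` plus `2 * ε`.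
  · have e : w v * (-w v / (1 - q v) - w v / q v) = -(1 / (1 - q v) + 1 / q v) := by
      linear_combination (-(1 / (1 - q v) + 1 / q v)) * hwv
    have e' : ε * (w v * (-(2 * w v))) = -(2 * ε) := by linear_combination (-2 * ε) * hwv
    rw [e, e']
    linarith
  · filter_upwards [ev] with t ht
    have hS : ∀ i ∉ S, q i + t * w i = 0 := fun i hi => by simp [hqS i hi, hw0 i (hqS i hi)]
    have hP : (fun i => q i + t * w i) ∈ G.indepPolytope :=
      ⟨fun i => (ht.1 i).1.elim le_of_lt fun h => by simpa [h] using hq.1 i,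
        fun i => (ht.1 i).2.le, fun i k hik => (ht.2 i k hik).le⟩
    simpa using hmax' _ hP hS

/-! ### Counting independent sets and the induction -/

/-- The number of independent sets contained in `S`. -/
noncomputable def numIndep (G : SimpleGraph V) (S : Finset V) : ℕ :=
  {s : Finset V | s ⊆ S ∧ G.IsIndepSet s}.ncard

theorem numIndep_pos (S : Finset V) : 0 < G.numIndep S :=
  (Set.ncard_pos (Set.toFinite _)).2 ⟨∅, by simp [IsIndepSet]⟩

/-- Independent sets are split by whether they contain `v`; removing `v` from those that do leaves
sets avoiding its neighbours. -/
theorem numIndep_clamp {S : Finset V} {v : V} (hv : v ∈ S) :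
    G.numIndep (S.erase v) + G.numIndep ((S.erase v) \ G.neighborFinset v) = G.numIndep S := by
  have hinj : Set.InjOn (insert v)
      {s : Finset V | s ⊆ (S.erase v) \ G.neighborFinset v ∧ G.IsIndepSet s} := by
    intro s hs t ht h
    have h1 : v ∉ s := fun h => by simpa using hs.1 h
    have h2 : v ∉ t := fun h => by simpa using ht.1 h
    rw [← Finset.erase_insert h1, h, Finset.erase_insert h2]
  unfold numIndep
  rw [← hinj.ncard_image, ← Set.ncard_union_eq _ (Set.toFinite _) (Set.toFinite _)]
  · congr 1
    ext s
    simp only [Set.mem_union, Set.mem_ofPred_eq, Set.mem_image]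
    constructor
    · rintro (⟨h, hs⟩ | ⟨t, ⟨h, ht⟩, rfl⟩)
      · exact ⟨h.trans (Finset.erase_subset _ _), hs⟩
      · refine ⟨Finset.insert_subset hv (h.trans (Finset.sdiff_subset.trans
          (Finset.erase_subset _ _))), ?_⟩
        have hsymm : Std.Symm fun a b => ¬G.Adj a b := ⟨fun a b h h' => h h'.symm⟩
        rw [Finset.coe_insert, IsIndepSet, Set.pairwise_insert_of_symm]
        refine ⟨ht, fun b hb _ => ?_⟩
        have := h hb
        simp only [Finset.mem_sdiff, mem_neighborFinset] at this
        exact this.2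
    · rintro ⟨h, hs⟩
      by_cases hvs : v ∈ s
      · right
        refine ⟨s.erase v, ⟨fun i hi => ?_, hs.mono (by simp)⟩, Finset.insert_erase hvs⟩
        obtain ⟨hiv, his⟩ := Finset.mem_erase.1 hi
        simp only [Finset.mem_sdiff, Finset.mem_erase, mem_neighborFinset]
        exact ⟨⟨hiv, h his⟩, hs hvs his hiv.symm⟩
      · exact Or.inl ⟨fun i hi => Finset.mem_erase.2 ⟨by rintro rfl; exact hvs hi, h hi⟩, hs⟩
  · rw [Set.disjoint_left]
    rintro _ ⟨h, -⟩ ⟨t, -, rfl⟩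
    simpa using h (Finset.mem_insert_self v t)

theorem negMulLog_add_mul_log_le {x y : ℝ} (hx : 0 ≤ x) (hy : 0 < y) :
    negMulLog x + x * log y ≤ y - x := by
  rcases hx.eq_or_lt with rfl | hx
  · simpa using hy.le
  · have := mul_le_mul_of_nonneg_left (log_le_sub_one_of_pos (div_pos hy hx)) hx.le
    rw [log_div hy.ne' hx.ne', mul_sub, mul_sub, mul_div_cancel₀ _ hx.ne'] at this
    rw [negMulLog]
    linarith

/-- Gibbs' inequality against the distribution with weights a/(a+b) and b/(a+b), obtained by adding
the pointwise bound for both outcomes. -/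
theorem binEntropy_add_log_le {x a b : ℝ} (h0 : 0 ≤ x) (h1 : x ≤ 1) (ha : 0 < a) (hb : 0 < b) :
    negMulLog x + negMulLog (1 - x) + (1 - x) * log a + x * log b ≤ log (a + b) := by
  have hab : 0 < a + b := add_pos ha hb
  have e1 := negMulLog_add_mul_log_le h0 (div_pos hb hab)
  have e2 := negMulLog_add_mul_log_le (sub_nonneg.2 h1) (div_pos ha hab)
  rw [log_div hb.ne' hab.ne'] at e1
  rw [log_div ha.ne' hab.ne'] at e2
  have e3 : a / (a + b) + b / (a + b) = 1 := by rw [← add_div, div_self hab.ne']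
  linarith

/-- An occupied vertex with empty neighbours contributes nothing, so it can be deleted together with
its neighbours; this identifies the face `p v = 1` with a smaller instance of the induction. -/
theorem indepBethe_update_zero {p : V → ℝ} {v : V} (hv : p v = 1)
    (hk : ∀ k, G.Adj v k → p k = 0) : G.indepBethe (update p v 0) = G.indepBethe p := by
  refine Finset.sum_congr rfl fun i _ => ?_
  rcases eq_or_ne i v with rfl | h
  · simp only [update_self, hv, negMulLog_zero, negMulLog_one, sub_zero, sub_self]
    congr 1
    refine Finset.sum_congr rfl fun k hk' => ?_
    have : G.Adj i k := by simpa using hk'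
    rw [update_of_ne this.ne', hk k this]
    simp
  · rw [update_of_ne h]
    congr 1
    refine Finset.sum_congr rfl fun k hk' => ?_
    have hik : G.Adj i k := by simpa using hk'
    rcases eq_or_ne k v with rfl | h'
    · simp [hv, hk i hik.symm]
    · rw [update_of_ne h']

theorem IsBipartite.indepBethe_le_log_numIndep (hG : G.IsBipartite) (S : Finset V) :
    ∀ p ∈ G.indepPolytope, (∀ i ∉ S, p i = 0) → G.indepBethe p ≤ log (G.numIndep S) := by
  induction S using Finset.strongInduction with
  | H S ih =>
    intro p hp hpS
    rcases S.eq_empty_or_nonempty with rfl | ⟨v, hv⟩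
    · have hp0 : p = 0 := funext fun i => hpS i (by simp)
      have : G.indepBethe p = 0 := by simp [indepBethe, hp0]
      rw [this]
      exact log_nonneg (by exact_mod_cast G.numIndep_pos ∅)
    · have hclamp := hG.indepBethe_le_of_clamp hv (a₀ := log (G.numIndep (S.erase v)))
        (a₁ := log (G.numIndep ((S.erase v) \ G.neighborFinset v))) ?_ ?_ hp hpS
      · refine hclamp.trans ?_
        rw [← numIndep_clamp hv, Nat.cast_add]
        exact binEntropy_add_log_le (hp.1 v) (hp.2.1 v) (by exact_mod_cast numIndep_pos _)
          (by exact_mod_cast numIndep_pos _)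
      · intro q hq hqS hqv
        refine ih _ (Finset.erase_ssubset hv) q hq fun i hi => ?_
        rcases eq_or_ne i v with rfl | h
        · exact hqv
        · exact hqS i fun h' => hi (Finset.mem_erase.2 ⟨h, h'⟩)
      · intro q hq hqS hqv
        have hk : ∀ k, G.Adj v k → q k = 0 := fun k hk => by
          linarith [hq.2.2 v k hk, hq.1 k]
        rw [← indepBethe_update_zero hqv hk]
        refine ih _ (Finset.sdiff_subset.trans_ssubset (Finset.erase_ssubset hv)) _
          ⟨fun i => ?_, fun i => ?_, fun i k hik => ?_⟩ fun i hi => ?_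
        · rcases eq_or_ne i v with rfl | h <;> simp [*, hq.1 i]
        · rcases eq_or_ne i v with rfl | h <;> simp [*, hq.2.1 i]
        · rcases eq_or_ne i v with rfl | h
          · simp [hik.ne', hk k hik]
          · rcases eq_or_ne k v with rfl | h'
            · simp [h, hk i hik.symm]
            · simpa [h, h'] using hq.2.2 i k hik
        · rcases eq_or_ne i v with rfl | h
          · simp
          · rw [update_of_ne h]
            by_cases hiv : G.Adj v i
            · exact hk i hiv
            · refine hqS i fun h' => hi ?_
              simp [h, h', hiv]

end SimpleGraph

/-! ### Translation from the factor graph model -/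

/-- No condition on the other terms is needed because `⊥ + ⊤ = ⊥` in `EReal`. -/
theorem EReal.sum_eq_bot {ι : Type*} {s : Finset ι} {f : ι → EReal} {i : ι} (hi : i ∈ s)
    (h : f i = ⊥) : ∑ j ∈ s, f j = ⊥ := by
  classical rw [← Finset.add_sum_erase _ _ hi, h, EReal.bot_add]

theorem BinaryModel.betheApprox_eq_zero {V : Type*} [Fintype V] [DecidableEq V]
    {M : BinaryModel V} {τ : M.PseudoMarginal} {α : M.factors} {x : α.1 → Fin 2}
    (hx : M.factorPot α x = 0) (hτ : 0 < τ.2 α x) : M.betheApprox τ = 0 := by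
  have h : M.betheEnergy τ = ⊥ := by
    have hterm : (τ.2 α x : EReal) * ENNReal.log (ENNReal.ofReal (M.factorPot α x)) = ⊥ := by
      rw [hx, ENNReal.ofReal_zero, ENNReal.log_zero, EReal.coe_mul_bot_of_pos hτ]
    rw [betheEnergy, EReal.sum_eq_bot (Finset.mem_univ α)
      (EReal.sum_eq_bot (Finset.mem_univ x) hterm), EReal.add_bot]
  rw [betheApprox, h, EReal.bot_add, EReal.exp_bot]

namespace SimpleGraph

open Real

variable {V : Type*} [Fintype V] [DecidableEq V] {G : SimpleGraph V} [DecidableRel G.Adj]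

theorem sum_neighborFinset_eq_two_mul_sum_edgeFinset (f : Sym2 V → ℝ) :
    ∑ i, ∑ k ∈ G.neighborFinset i, f s(i, k) = 2 * ∑ e ∈ G.edgeFinset, f e := by
  have h1 : ∀ i, ∑ k ∈ G.neighborFinset i, f s(i, k) =
      ∑ e ∈ G.edgeFinset with i ∈ e, f e := by
    intro i
    have : {e ∈ G.edgeFinset | i ∈ e} = (G.neighborFinset i).image fun k => s(i, k) := by
      ext e
      simp only [Finset.mem_filter, mem_edgeFinset, Finset.mem_image, mem_neighborFinset]
      constructor
      · rintro ⟨he, k, rfl⟩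
        exact ⟨k, he, rfl⟩
      · rintro ⟨k, hk, rfl⟩
        exact ⟨hk, Sym2.mem_mk_left i k⟩
    rw [this, Finset.sum_image fun a _ b _ h => Sym2.congr_right.1 h]
  simp only [h1, Finset.sum_filter]
  rw [Finset.sum_comm, Finset.mul_sum]
  refine Finset.sum_congr rfl fun e he => ?_
  have h2 : ({i | i ∈ e} : Finset V) = e.toFinset := by ext; simp
  rw [← Finset.sum_filter, Finset.sum_const, h2,
    Sym2.card_toFinset_of_not_isDiag e (G.not_isDiag_of_mem_edgeFinset he)]
  simp

/-- The assignment of the values `a` to `i` and `b` to `j`. -/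
def pairAssignment (i j : V) (a b : Fin 2) : ({i, j} : Finset V) → Fin 2 :=
  fun k => if k.1 = i then a else b

theorem sum_pairAssignment {M : Type*} [AddCommMonoid M] {i j : V} (hij : i ≠ j)
    (f : (({i, j} : Finset V) → Fin 2) → M) :
    ∑ x, f x = ∑ a, ∑ b, f (pairAssignment i j a b) := by
  rw [← Fintype.sum_prod_type']
  refine (Fintype.sum_equiv
    { toFun := fun ab : Fin 2 × Fin 2 => pairAssignment i j ab.1 ab.2
      invFun := fun x => (x ⟨i, by simp⟩, x ⟨j, by simp⟩)
      left_inv := fun ab => by simp [pairAssignment, hij.symm]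
      right_inv := fun x => by
        ext ⟨k, hk⟩
        rcases Finset.mem_insert.1 hk with rfl | hk'
        · simp [pairAssignment]
        · obtain rfl := Finset.mem_singleton.1 hk'
          simp [pairAssignment, hij.symm] } _ _ fun _ => rfl).symm

theorem prod_pairAssignment {M : Type*} [CommMonoid M] {i j : V} (hij : i ≠ j)
    (f : V → Fin 2 → M) (a b : Fin 2) :
    ∏ k : ({i, j} : Finset V), f k.1 (pairAssignment i j a b k) = f i a * f j b := by
  refine (Finset.prod_coe_sort {i, j} fun k => f k (if k = i then a else b)).trans ?_
  rw [Finset.prod_pair hij, if_pos rfl, if_neg hij.symm]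

theorem mem_independentSetModel_factors {s : Finset V} :
    s ∈ (independentSetModel G).factors ↔ ∃ i j, G.Adj i j ∧ s = {i, j} := by
  simp only [independentSetModel, Finset.mem_image, mem_edgeFinset]
  constructor
  · rintro ⟨e, he, rfl⟩
    induction e with
    | _ i j => exact ⟨i, j, he, Sym2.toFinset_mk_eq⟩
  · rintro ⟨i, j, hij, rfl⟩
    exact ⟨s(i, j), hij, Sym2.toFinset_mk_eq⟩

theorem factorPot_pairAssignment {i j : V} (hij : i ≠ j)
    (hs : {i, j} ∈ (independentSetModel G).factors) (a b : Fin 2) :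
    (independentSetModel G).factorPot ⟨{i, j}, hs⟩ (pairAssignment i j a b) =
      1 - ((a : ℕ) : ℝ) * ((b : ℕ) : ℝ) :=
  congrArg (1 - ·) (prod_pairAssignment hij (fun _ c => ((c : ℕ) : ℝ)) a b)

theorem sum_factors (f : Finset V → ℝ) :
    ∑ α : (independentSetModel G).factors, f α.1 =
      (∑ i, ∑ k ∈ G.neighborFinset i, f {i, k}) / 2 := by
  have h := G.sum_neighborFinset_eq_two_mul_sum_edgeFinset fun e => f e.toFinset
  simp only [Sym2.toFinset_mk_eq] at h
  rw [h, mul_div_cancel_left₀ _ two_ne_zero, Finset.sum_coe_sort]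
  refine Finset.sum_image fun a _ b _ hab => Sym2.ext fun i => ?_
  rw [← Sym2.mem_toFinset, ← Sym2.mem_toFinset]
  exact iff_of_eq (congrArg (i ∈ ·) hab)

/-- The pseudomarginals of pairs that do not charge `(1, 1)` are determined by the marginals. -/
theorem pairAssignment_marginals {τ : (independentSetModel G).PseudoMarginal}
    (hτ : τ ∈ (independentSetModel G).localMarginalPolytope) {i j : V} (hij : i ≠ j)
    (hs : {i, j} ∈ (independentSetModel G).factors)
    (h11 : τ.2 ⟨{i, j}, hs⟩ (pairAssignment i j 1 1) = 0) :
    τ.2 ⟨{i, j}, hs⟩ (pairAssignment i j 1 0) = τ.1 i 1 ∧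
      τ.2 ⟨{i, j}, hs⟩ (pairAssignment i j 0 1) = τ.1 j 1 ∧
      τ.2 ⟨{i, j}, hs⟩ (pairAssignment i j 0 0) = 1 - τ.1 i 1 - τ.1 j 1 := by
  have hi : ∀ c, ∑ b, τ.2 ⟨{i, j}, hs⟩ (pairAssignment i j c b) = τ.1 i c := by
    intro c
    rw [← hτ.2.2.1 ⟨{i, j}, hs⟩ ⟨i, by simp⟩ c, Finset.sum_filter]
    erw [sum_pairAssignment hij]
    simp only [Fin.sum_univ_two, pairAssignment]
    fin_cases c <;> simp
  have hj : ∀ c, ∑ a, τ.2 ⟨{i, j}, hs⟩ (pairAssignment i j a c) = τ.1 j c := by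
    intro c
    rw [← hτ.2.2.1 ⟨{i, j}, hs⟩ ⟨j, by simp⟩ c, Finset.sum_filter]
    erw [sum_pairAssignment hij]
    simp only [Fin.sum_univ_two, pairAssignment]
    fin_cases c <;> simp [hij.symm]
  have h1 := hi 1
  have h2 := hj 1
  have h3 := hi 0
  have h4 := hτ.2.2.2 i
  rw [Fin.sum_univ_two] at h1 h2 h3 h4
  refine ⟨?_, ?_, ?_⟩ <;> linarith

theorem betheEnergy_eq_zero {τ : (independentSetModel G).PseudoMarginal}
    (h : ∀ α x, (independentSetModel G).factorPot α x = 0 → τ.2 α x = 0) :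
    (independentSetModel G).betheEnergy τ = 0 := by
  rw [BinaryModel.betheEnergy, Finset.sum_eq_zero, Finset.sum_eq_zero, add_zero]
  · rintro ⟨s, hs⟩ -
    obtain ⟨i, j, hij, rfl⟩ := mem_independentSetModel_factors.1 hs
    erw [sum_pairAssignment hij.ne]
    have h11 := h ⟨_, hs⟩ (pairAssignment i j 1 1) (by simp [factorPot_pairAssignment hij.ne])
    refine Finset.sum_eq_zero fun a _ => Finset.sum_eq_zero fun b _ => ?_
    rw [factorPot_pairAssignment hij.ne]
    fin_cases a <;> fin_cases b <;> simp [h11]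
  · intro i _
    simp [independentSetModel]

/-- The three summands are the mutual information of an edge without mass at `(1, 1)`. Zero
denominators are harmless, since they occur only with a zero coefficient or where the default `log 0
= 0` agrees on both sides. -/
theorem entropy_term {p q : ℝ} (hp : 0 ≤ p) (hq : 0 ≤ q) (hpq : p + q ≤ 1) :
    (1 - p - q) * log ((1 - p - q) / ((1 - p) * (1 - q))) + q * log (q / ((1 - p) * q)) +
      p * log (p / (p * (1 - q))) =
    -negMulLog (1 - p - q) + negMulLog (1 - p) + negMulLog (1 - q) := by
  have h1 : q * log (q / ((1 - p) * q)) = -(q * log (1 - p)) := by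
    rcases eq_or_ne q 0 with rfl | hq0
    · simp
    · rw [div_mul_cancel_right₀ hq0, log_inv, mul_neg]
  have h2 : p * log (p / (p * (1 - q))) = -(p * log (1 - q)) := by
    rcases eq_or_ne p 0 with rfl | hp0
    · simp
    · rw [div_mul_cancel_left₀ hp0, log_inv, mul_neg]
  have h3 : (1 - p - q) * log ((1 - p - q) / ((1 - p) * (1 - q))) =
      (1 - p - q) * (log (1 - p - q) - (log (1 - p) + log (1 - q))) := by
    rcases eq_or_ne (1 - p - q) 0 with h | h
    · simp [h]
    · have h' : 0 < 1 - p - q := lt_of_le_of_ne (by linarith) h.symm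
      have e1 : 1 - p ≠ 0 := by linarith
      have e2 : 1 - q ≠ 0 := by linarith
      rw [log_div h (mul_ne_zero e1 e2), log_mul e1 e2]
  rw [h1, h2, h3]
  simp only [negMulLog]
  ring

theorem mem_indepPolytope_of_mem_localMarginalPolytope
    {τ : (independentSetModel G).PseudoMarginal}
    (hτ : τ ∈ (independentSetModel G).localMarginalPolytope)
    (h : ∀ α x, (independentSetModel G).factorPot α x = 0 → τ.2 α x = 0) :
    (fun i => τ.1 i 1) ∈ G.indepPolytope := by
  refine ⟨fun i => hτ.1 i 1, fun i => ?_, fun i j hij => ?_⟩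
  · have := hτ.2.2.2 i
    rw [Fin.sum_univ_two] at this
    linarith [hτ.1 i 0]
  · have hs : {i, j} ∈ (independentSetModel G).factors :=
      mem_independentSetModel_factors.2 ⟨i, j, hij, rfl⟩
    have h3 := (pairAssignment_marginals hτ hij.ne hs
      (h _ _ (by simp [factorPot_pairAssignment hij.ne]))).2.2
    linarith [hτ.2.1 ⟨_, hs⟩ (pairAssignment i j 0 0)]

theorem betheEntropy_eq_indepBethe {τ : (independentSetModel G).PseudoMarginal}
    (hτ : τ ∈ (independentSetModel G).localMarginalPolytope)
    (h : ∀ α x, (independentSetModel G).factorPot α x = 0 → τ.2 α x = 0) :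
    (independentSetModel G).betheEntropy τ = G.indepBethe fun i => τ.1 i 1 := by
  have hp := mem_indepPolytope_of_mem_localMarginalPolytope hτ h
  have h0 : ∀ i, τ.1 i 0 = 1 - τ.1 i 1 := fun i => by
    have := hτ.2.2.2 i
    rw [Fin.sum_univ_two] at this
    linarith
  have hα : ∀ α : (independentSetModel G).factors, ∑ x : α.1 → Fin 2,
      τ.2 α x * log (τ.2 α x / ∏ i : α.1, τ.1 i.1 (x i)) =
      -negMulLog (1 - ∑ i ∈ α.1, τ.1 i 1) + ∑ i ∈ α.1, negMulLog (1 - τ.1 i 1) := by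
    rintro ⟨s, hs⟩
    obtain ⟨i, j, hij, rfl⟩ := mem_independentSetModel_factors.1 hs
    have h11 := h ⟨_, hs⟩ (pairAssignment i j 1 1) (by simp [factorPot_pairAssignment hij.ne])
    obtain ⟨e10, e01, e00⟩ := pairAssignment_marginals hτ hij.ne hs h11
    have hprod := fun a b => prod_pairAssignment hij.ne τ.1 a b
    erw [sum_pairAssignment hij.ne]
    simp only [Fin.sum_univ_two]
    erw [hprod 0 0, hprod 0 1, hprod 1 0, hprod 1 1]
    rw [e00, e01, e10, h11, zero_mul, add_zero, h0, h0, Finset.sum_pair hij.ne,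
      Finset.sum_pair hij.ne, ← sub_sub, ← add_assoc]
    exact entropy_term (hp.1 i) (hp.1 j) (hp.2.2 i j hij)
  rw [BinaryModel.betheEntropy, Finset.sum_congr rfl fun α _ => hα α,
    sum_factors fun s => -negMulLog (1 - ∑ i ∈ s, τ.1 i 1) + ∑ i ∈ s, negMulLog (1 - τ.1 i 1)]
  have hpair : ∀ i, ∀ k ∈ G.neighborFinset i, -negMulLog (1 - ∑ i ∈ {i, k}, τ.1 i 1) +
      ∑ i ∈ {i, k}, negMulLog (1 - τ.1 i 1) = -negMulLog (1 - τ.1 i 1 - τ.1 k 1) +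
        (negMulLog (1 - τ.1 i 1) + negMulLog (1 - τ.1 k 1)) := by
    intro i k hk
    have hik : i ≠ k := ((G.mem_neighborFinset i k).1 hk).ne
    rw [Finset.sum_pair hik, Finset.sum_pair hik, sub_sub]
  rw [Finset.sum_congr rfl fun i _ => Finset.sum_congr rfl (hpair i)]
  have hs := G.sum_neighborFinset_comm fun _ k => negMulLog (1 - τ.1 k 1)
  simp only [Finset.sum_add_distrib, hs]
  simp only [indepBethe, Fin.sum_univ_two, h0, Finset.sum_add_distrib, Finset.sum_sub_distrib,
    Finset.sum_neg_distrib, ← Finset.sum_div, negMulLog, neg_mul]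
  ring

theorem betheApprox_eq_exp_indepBethe {τ : (independentSetModel G).PseudoMarginal}
    (hτ : τ ∈ (independentSetModel G).localMarginalPolytope)
    (h : ∀ α x, (independentSetModel G).factorPot α x = 0 → τ.2 α x = 0) :
    (independentSetModel G).betheApprox τ =
      ENNReal.ofReal (exp (G.indepBethe fun i => τ.1 i 1)) := by
  rw [BinaryModel.betheApprox, betheEnergy_eq_zero h, betheEntropy_eq_indepBethe hτ h, zero_add,
    EReal.exp_coe]

theorem exists_betheApprox_eq {p : V → ℝ} (hp : p ∈ G.indepPolytope) :
    ∃ τ ∈ (independentSetModel G).localMarginalPolytope,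
      (independentSetModel G).betheApprox τ = ENNReal.ofReal (exp (G.indepBethe p)) := by
  -- On a pair, the first summand puts the mass `1 - p i - p j` on `(0, 0)`; the second puts `p i`
  -- and `p j` on the configurations with a single `1`, and its prefactor kills `(1, 1)`.
  set τ : (independentSetModel G).PseudoMarginal :=
    (fun i a => if a = 1 then p i else 1 - p i, fun α x =>
      (∏ i : α.1, (1 - ((x i : ℕ) : ℝ))) * (1 - ∑ i ∈ α.1, p i) +
        (1 - ∏ i : α.1, ((x i : ℕ) : ℝ)) * ∑ i : α.1, ((x i : ℕ) : ℝ) * p i.1) with hτdef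
  have hval : ∀ {i j : V} (hij : i ≠ j) (hs : {i, j} ∈ (independentSetModel G).factors)
      (a b : Fin 2), τ.2 ⟨{i, j}, hs⟩ (pairAssignment i j a b) =
        (1 - ((a : ℕ) : ℝ)) * (1 - ((b : ℕ) : ℝ)) * (1 - (p i + p j)) +
          (1 - ((a : ℕ) : ℝ) * ((b : ℕ) : ℝ)) * (((a : ℕ) : ℝ) * p i + ((b : ℕ) : ℝ) * p j) := by
    intro i j hij hs a b
    have e1 := prod_pairAssignment hij (fun _ c => (1 - ((c : ℕ) : ℝ))) a b
    have e2 := prod_pairAssignment hij (fun _ c => ((c : ℕ) : ℝ)) a b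
    have e3 : ∑ k : ({i, j} : Finset V), ((pairAssignment i j a b k : ℕ) : ℝ) * p k.1 =
        ((a : ℕ) : ℝ) * p i + ((b : ℕ) : ℝ) * p j :=
      prod_pairAssignment (M := Multiplicative ℝ) hij
        (fun k c => Multiplicative.ofAdd (((c : ℕ) : ℝ) * p k)) a b
    simp only [hτdef]
    erw [e1, e2, e3]
    rw [Finset.sum_pair hij]
  have hτ : τ ∈ (independentSetModel G).localMarginalPolytope := by
    refine ⟨fun i a => ?_, ?_, ?_, fun i => ?_⟩
    · simp only [hτdef]
      split_ifs
      · exact hp.1 i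
      · linarith [hp.2.1 i]
    · rintro ⟨s, hs⟩ x
      have hx : ∀ i, ((x i : ℕ) : ℝ) ≤ 1 := fun i => by
        exact_mod_cast Nat.lt_succ_iff.1 (x i).isLt
      have hsum : ∑ i ∈ s, p i ≤ 1 := by
        obtain ⟨i, j, hij, rfl⟩ := mem_independentSetModel_factors.1 hs
        rw [Finset.sum_pair hij.ne]
        exact hp.2.2 i j hij
      refine add_nonneg (mul_nonneg (Finset.prod_nonneg fun i _ => sub_nonneg.2 (hx i))
        (sub_nonneg.2 hsum)) (mul_nonneg (sub_nonneg.2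
          (Finset.prod_le_one (fun i _ => Nat.cast_nonneg _) fun i _ => hx i))
          (Finset.sum_nonneg fun i _ => mul_nonneg (Nat.cast_nonneg _) (hp.1 i)))
    · rintro ⟨s, hs⟩ ⟨k, hk⟩ c
      obtain ⟨i, j, hij, rfl⟩ := mem_independentSetModel_factors.1 hs
      rw [Finset.sum_filter]
      erw [sum_pairAssignment hij.ne]
      simp only [hval hij.ne hs, Fin.sum_univ_two]
      rcases Finset.mem_insert.1 hk with rfl | hk
      · simp only [pairAssignment, hτdef]
        fin_cases c <;> simp <;> ring
      · obtain rfl := Finset.mem_singleton.1 hk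
        simp only [pairAssignment, hτdef, if_neg hij.ne.symm]
        fin_cases c <;> simp <;> ring
    · simp [hτdef, Fin.sum_univ_two]
  have h : ∀ α x, (independentSetModel G).factorPot α x = 0 → τ.2 α x = 0 := by
    rintro ⟨s, hs⟩ x hx
    have hx1 : ∏ i : s, ((x i : ℕ) : ℝ) = 1 := (sub_eq_zero.1 hx).symm
    obtain ⟨i, hi⟩ := (independentSetModel G).factors_nonempty s hs
    have hi1 : x ⟨i, hi⟩ ≠ 0 := fun h0 => by
      rw [Finset.prod_eq_zero (Finset.mem_univ ⟨i, hi⟩) (by simp [h0])] at hx1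
      exact zero_ne_one hx1
    have hi1' : x ⟨i, hi⟩ = 1 := Fin.eq_one_of_ne_zero _ hi1
    simp only [hτdef]
    rw [hx1, Finset.prod_eq_zero (Finset.mem_univ ⟨i, hi⟩) (by simp [hi1'])]
    simp
  refine ⟨τ, hτ, ?_⟩
  rw [betheApprox_eq_exp_indepBethe hτ h]
  simp [hτdef]

/-! ### The partition function as a count -/

theorem numIndep_univ : G.numIndep Finset.univ = {s : Set V | G.IsIndepSet s}.ncard := by
  rw [numIndep, ← Set.ncard_image_of_injective _ Finset.coe_injective]
  congr 1
  ext s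
  simp only [Set.mem_image, Set.mem_ofPred_eq, Finset.subset_univ, true_and]
  constructor
  · rintro ⟨t, ht, rfl⟩
    exact ht
  · exact fun h => ⟨s.toFinite.toFinset, by simpa using h, by simp⟩

theorem weight_independentSetModel (x : V → Fin 2) [Decidable (G.IsIndepSet {i | x i = 1})] :
    (independentSetModel G).weight x = if G.IsIndepSet {i | x i = 1} then 1 else 0 := by
  have hnode : ∏ i, (independentSetModel G).nodePot i (x i) = 1 :=
    Finset.prod_eq_one fun _ _ => rfl
  have hpair : ∀ (i j : V) (hij : G.Adj i j) (hs : {i, j} ∈ (independentSetModel G).factors),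
      (independentSetModel G).factorPot ⟨{i, j}, hs⟩ (fun k => x k.1) =
        1 - ((x i : ℕ) : ℝ) * ((x j : ℕ) : ℝ) := by
    intro i j hij hs
    refine congrArg (1 - ·) ?_
    exact (Finset.prod_coe_sort {i, j} fun k => ((x k : ℕ) : ℝ)).trans (Finset.prod_pair hij.ne)
  rw [BinaryModel.weight, hnode, one_mul]
  split_ifs with h
  · refine Finset.prod_eq_one ?_
    rintro ⟨s, hs⟩ -
    obtain ⟨i, j, hij, rfl⟩ := mem_independentSetModel_factors.1 hs
    erw [hpair i j hij hs]
    by_cases hi : x i = 1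
    · by_cases hj : x j = 1
      · exact absurd hij (h hi hj hij.ne)
      · simp [show x j = 0 by omega]
    · simp [show x i = 0 by omega]
  · simp only [IsIndepSet, Set.Pairwise, Set.mem_ofPred_eq] at h
    push Not at h
    obtain ⟨i, hi, j, hj, -, hij⟩ := h
    refine Finset.prod_eq_zero (Finset.mem_univ
      ⟨{i, j}, mem_independentSetModel_factors.2 ⟨i, j, hij, rfl⟩⟩) ?_
    erw [hpair i j hij]
    simp [hi, hj]

theorem partitionFunction_independentSetModel :
    (independentSetModel G).partitionFunction = ({s : Set V | G.IsIndepSet s}.ncard : ℝ) := by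
  classical
  have hinj : Function.Injective fun x : V → Fin 2 => {i | x i = 1} := by
    intro x y h
    funext i
    have hi : x i = 1 ↔ y i = 1 := Set.ext_iff.1 h i
    by_cases hx : x i = 1
    · rw [hx, hi.1 hx]
    · have hy := mt hi.2 hx
      omega
  have himage : {s : Set V | G.IsIndepSet s} = (fun x : V → Fin 2 => {i | x i = 1}) ''
      {x | G.IsIndepSet {i | x i = 1}} := by
    ext s
    simp only [Set.mem_image, Set.mem_ofPred_eq]
    constructor
    · intro h
      have hs : {i | (if i ∈ s then (1 : Fin 2) else 0) = 1} = s := by ext i; simp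
      exact ⟨fun i => if i ∈ s then 1 else 0, by rwa [hs], hs⟩
    · rintro ⟨x, hx, rfl⟩
      exact hx
  rw [BinaryModel.partitionFunction, Finset.sum_congr rfl fun x _ => weight_independentSetModel x,
    Finset.sum_boole, himage, Set.ncard_image_of_injective _ hinj, ← Set.ncard_coe_finset]
  simp

end SimpleGraph

/-! ### Attainment and the bound -/

open SimpleGraph in
theorem mainTheorem5 {V : Type*} [Fintype V] [DecidableEq V] (G : SimpleGraph V)
    [DecidableRel G.Adj] (hG : G.IsBipartite) :
    IsGreatest
        ((independentSetModel G).betheApprox '' (independentSetModel G).localMarginalPolytope)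
        (independentSetModel G).bethePartitionFunction ∧
      (independentSetModel G).bethePartitionFunction ≤
        ENNReal.ofReal (independentSetModel G).partitionFunction ∧
      (independentSetModel G).partitionFunction =
        ({s : Set V | G.IsIndepSet s}.ncard : ℝ) := by
  have hne : G.indepPolytope.Nonempty := ⟨fun _ => 0, by simp [indepPolytope]⟩
  obtain ⟨p, hp, hmax⟩ :=
    G.isCompact_indepPolytope.exists_isMaxOn hne G.continuous_indepBethe.continuousOn
  obtain ⟨τ, hτ, hτp⟩ := exists_betheApprox_eq hp
  have hgreatest : IsGreatest
      ((independentSetModel G).betheApprox '' (independentSetModel G).localMarginalPolytope)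
      (ENNReal.ofReal (Real.exp (G.indepBethe p))) := by
    refine ⟨⟨τ, hτ, hτp⟩, ?_⟩
    rintro _ ⟨σ, hσ, rfl⟩
    by_cases h : ∀ α x, (independentSetModel G).factorPot α x = 0 → σ.2 α x = 0
    · rw [betheApprox_eq_exp_indepBethe hσ h]
      exact ENNReal.ofReal_le_ofReal (Real.exp_le_exp.2
        (isMaxOn_iff.1 hmax _ (mem_indepPolytope_of_mem_localMarginalPolytope hσ h)))
    · push Not at h
      obtain ⟨α, x, hx, hne⟩ := h
      rw [BinaryModel.betheApprox_eq_zero hx (lt_of_le_of_ne (hσ.2.1 α x) hne.symm)]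
      exact zero_le
  have hB : (independentSetModel G).bethePartitionFunction =
      ENNReal.ofReal (Real.exp (G.indepBethe p)) := hgreatest.csSup_eq
  refine ⟨hB ▸ hgreatest, ?_, partitionFunction_independentSetModel⟩
  rw [hB, partitionFunction_independentSetModel, ← numIndep_univ]
  refine ENNReal.ofReal_le_ofReal ?_
  rw [← Real.le_log_iff_exp_le (by exact_mod_cast numIndep_pos _)]
  exact hG.indepBethe_le_log_numIndep Finset.univ p hp fun i hi => absurd (Finset.mem_univ i) hi
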